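/- **Proposition (Orthogonality relations).** Let $\mathcal G$ be a compact Hausdorff topological groupoid with unit space $X$, source and range maps $s,r$, and put $\mathcal G_u^v=\{x\in\mathcal G: s(x)=u,\ r(x)=v\}$, $\mathcal G^u=r^{-1}(u)$. Let $\lambda_u^v$ be the normalized Haar measure on $\mathcal G_u^v$: the translate of the Haar probability measure of the compact isotropy group $\mathcal G_u^u$ by any element of $\mathcal G_u^v$ (and $0$ if $\mathcal G_u^v=\emptyset$). A continuous unitary representation $\pi$ of $\mathcal G$ consists of a continuous field of Hilbert spaces $\{\mathcal H_u^\pi\}_{u\in X}$ and unitaries $\pi(x):\mathcal H^\pi_{s(x)}\to\mathcal H^\pi_{r(x)}$ with $\pi(u)=\mathrm{id}$ for units $u$ and $\pi(xy)=\pi(x)\pi(y)$, such that $x\mapsto\langle\pi(x)\xi_{s(x)},\eta_{r(x)}\rangle$ is continuous for all continuous sections $\xi,\eta$. It is irreducible if it is nonzero and has no invariant continuous subbundle of closed subspaces other than $0$ and itself. Two representations are equivalent if there is a unitary isomorphism of their bundles that intertwines them. Write $d_u^\pi=\dim\mathcal H_u^\pi$. Let $\tau,\rho$ be irreducible continuous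 unitary representations of $\mathcal G$. Then all fibres $\mathcal H_u^\tau,\mathcal H_u^\rho$ are finite-dimensional, and for all $u,v\in X$ the following integrals exist and have the stated values, where "$\tau=\rho$" is the case of one and the same representation and "$\tau\not\sim\rho$" the case of inequivalent ones (if $d^\tau_u=0$, the right-hand sides are read as $0$). (i) For every bounded operator $A:\mathcal H_u^\rho\to\mathcal H_u^\tau$, $$\int\tau(x)\,A\,\rho(x^{-1})\,d\lambda_u^v(x)=\begin{cases}\frac{\mathrm{Tr}(A)}{d_u^\tau}\,\mathrm{id}_{\mathcal H_v^\tau}&\tau=\rho,\\0&\tau\not\sim\rho.\end{cases}$$ (ii) For $\xi\in\mathcal H_u^\tau$, $\eta\in\mathcal H_v^\rho$, $$\int\tau(x)\xi\otimes\rho(x^{-1})\eta\,d\lambda_u^v(x)=\begin{cases}\frac{1}{d_u^\tau}\,\eta\otimes\xi&\tau=\rho,\\0&\tau\not\sim\rho.\end{cases}$$ (iii) For bounded $T:\mathcal H_v^\tau\to\mathcal H_u^\tau$, $S:\mathcal H_u^\rho\to\mathcal H_v^\rho$, $$\int\mathrm{Tr}(T\tau(x))\,\mathrm{Tr}(S\rho(x^{-1}))\,d\lambda_u^v(x)=\begin{cases}\frac{\mathrm{Tr}(TS)}{d_u^\tau}&\tau=\rho,\\0&\tau\not\sim\rho.\end{cases}$$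 (iv) For bounded $T:\mathcal H_v^\tau\to\mathcal H_u^\tau$, $S:\mathcal H_v^\rho\to\mathcal H_u^\rho$, $$\int\mathrm{Tr}(T\tau(x))\,\overline{\mathrm{Tr}(S\rho(x))}\,d\lambda_u^v(x)=\begin{cases}\frac{\mathrm{Tr}(TS^*)}{d_u^\tau}&\tau=\rho,\\0&\tau\not\sim\rho.\end{cases}$$ (v) For bounded $T:\mathcal H_v^\tau\to\mathcal H_u^\tau$, $$\int\mathrm{Tr}(T\tau(x))\,\rho(x^{-1})\,d\lambda_u^v(x)=\begin{cases}\frac{1}{d_u^\tau}\,T&\tau=\rho,\\0&\tau\not\sim\rho.\end{cases}$$ In particular ($v=u$) these hold on each isotropy group $\mathcal G_u^u$ with its Haar probability measure, with $A=A_u$, $\xi=\xi_u$, $\eta=\eta_u$, $T=T_u$, $S=S_u$ the values at $u$ of bundles of operators and of sections. Moreover, let $\{\lambda^u\}_{u\in X}$ be a normalized Haar system ($\lambda^u(\mathcal G^u)=1$) and let $A=\{A_w:\mathcal H_w^\rho\to\mathcal H_w^\tau\}_{w\in X}$ be a bundle of bounded operators that intertwines $\rho$ and $\tau$, i.e. $A_{r(x)}\rho(x)=\tau(x)A_{s(x)}$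 for all $x\in\mathcal G$. Then for every $u\in X$ $$\int_{\mathcal G^u}\tau(x)A_{s(x)}\rho(x^{-1})\,d\lambda^u(x)=\begin{cases}\frac{\mathrm{Tr}(A_u)}{d_u^\tau}\,\mathrm{id}_{\mathcal H_u^\tau}&\tau=\rho,\\0&\tau\not\sim\rho.\end{cases}$$ -/

import Mathlib

open CategoryTheory MeasureTheory Topology TensorProduct
open scoped ComplexConjugate

namespace GroupoidDuality

/-! ### Compact groupoids

A groupoid with unit space `X` is a small category `[Groupoid X]`; an arrow `x : u ⟶ v` has source
`u` and range `v`, so `u ⟶ v` is the set of arrows with source `u` and range `v`. The product `xy`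
of arrows with `s(x) = r(y)` is the composite `y ≫ x`. -/

/-- The set of all arrows of a groupoid. -/
structure Arr (X : Type*) [Groupoid X] where
  /-- the source of the arrow -/
  {src : X}
  /-- the range of the arrow -/
  {tgt : X}
  /-- the arrow itself -/
  hom : src ⟶ tgt

/-- The product `xy` of two arrows with `r(y) = s(x)`. -/
def Arr.comp {X : Type*} [Groupoid X] (x y : Arr X) (h : y.tgt = x.src) : Arr X :=
  ⟨y.hom ≫ eqToHom h ≫ x.hom⟩

/-- A topological groupoid: source, range, the unit map, inversion and multiplication of composable
arrows are continuous. (Then the unit map is a homeomorphism onto the set of units, so the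
topology of `X` is the one of the unit space.) -/
class TopologicalGroupoid (X : Type*) [Groupoid X] [TopologicalSpace X]
    [TopologicalSpace (Arr X)] : Prop where
  continuous_src : Continuous fun x : Arr X => x.src
  continuous_tgt : Continuous fun x : Arr X => x.tgt
  continuous_unit : Continuous fun u : X => (⟨𝟙 u⟩ : Arr X)
  continuous_inv : Continuous fun x : Arr X => (⟨Groupoid.inv x.hom⟩ : Arr X)
  continuous_comp : Continuous fun p : {p : Arr X × Arr X // p.2.tgt = p.1.src} =>
    Arr.comp p.1.1 p.1.2 p.2

section Topology

variable {X : Type*} [Groupoid X] [TopologicalSpace (Arr X)]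

/-- The set of arrows from `u` to `v` carries the subspace topology. -/
instance homTopology (u v : X) : TopologicalSpace (u ⟶ v) :=
  TopologicalSpace.induced (fun x => (⟨x⟩ : Arr X)) inferInstance

instance homMeasurableSpace (u v : X) : MeasurableSpace (u ⟶ v) := borel _

instance homBorelSpace (u v : X) : BorelSpace (u ⟶ v) := ⟨rfl⟩

theorem continuous_toArr (u v : X) : Continuous fun x : u ⟶ v => (⟨x⟩ : Arr X) :=
  continuous_induced_dom

variable [TopologicalSpace X] [TopologicalGroupoid X]

theorem continuous_homComp (u v w : X) :
    Continuous fun p : (u ⟶ v) × (v ⟶ w) => p.1 ≫ p.2 := by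
  refine continuous_induced_rng.2 ?_
  have h : Continuous fun p : (u ⟶ v) × (v ⟶ w) =>
      (⟨((⟨p.2⟩ : Arr X), (⟨p.1⟩ : Arr X)), rfl⟩ :
        {p : Arr X × Arr X // p.2.tgt = p.1.src}) :=
    Continuous.subtype_mk
      (((continuous_toArr v w).comp continuous_snd).prodMk
        ((continuous_toArr u v).comp continuous_fst)) _
  have h2 := TopologicalGroupoid.continuous_comp.comp h
  convert h2 using 1
  funext p
  simp [Arr.comp]

/-- The isotropy groups of a topological groupoid are topological groups. -/
instance isotropyIsTopologicalGroup (u : X) : IsTopologicalGroup (u ⟶ u) where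
  continuous_mul := continuous_homComp u u u
  continuous_inv := continuous_induced_rng.2
    (TopologicalGroupoid.continuous_inv.comp (continuous_toArr u u))

/-- The isotropy groups of a compact Hausdorff groupoid are compact. -/
instance isotropyCompactSpace [CompactSpace (Arr X)] [T2Space (Arr X)] (u : X) :
    CompactSpace (u ⟶ u) := by
  have hX : T2Space X := by
    refine T2Space.of_injective_continuous (f := fun u : X => (⟨𝟙 u⟩ : Arr X)) ?_
      TopologicalGroupoid.continuous_unit
    intro a b h
    exact congrArg Arr.src h
  have hinj : Function.Injective fun x : u ⟶ u => (⟨x⟩ : Arr X) := by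
    intro a b h
    simpa using h
  have hrange : Set.range (fun x : u ⟶ u => (⟨x⟩ : Arr X)) =
      {x : Arr X | x.src = u} ∩ {x : Arr X | x.tgt = u} := by
    ext x
    constructor
    · rintro ⟨y, rfl⟩
      exact ⟨rfl, rfl⟩
    · rintro ⟨h1, h2⟩
      obtain ⟨x⟩ := x
      simp only [Set.mem_ofPred_eq] at h1 h2
      subst h1
      subst h2
      exact ⟨x, rfl⟩
  refine (Topology.IsClosedEmbedding.mk ⟨⟨rfl⟩, hinj⟩ ?_).compactSpace
  rw [hrange]
  exact (isClosed_singleton.preimage TopologicalGroupoid.continuous_src).inter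
    (isClosed_singleton.preimage TopologicalGroupoid.continuous_tgt)

end Topology

/-! ### The measures -/

section Measures

variable {X : Type*} [Groupoid X] [TopologicalSpace (Arr X)]

open Classical in
/-- The normalized Haar measure `λ_u^v` on the set `u ⟶ v` of arrows with source `u` and range
`v`: the translate along any arrow `z : u ⟶ v` of the Haar probability measure of the isotropy
group `u ⟶ u` (it does not depend on `z`, because compact groups are unimodular), and `0` if there
is no arrow from `u` to `v`. For `v = u` it is the Haar probability measure of the isotropy
group. -/
noncomputable def homMeasure [TopologicalSpace X] [TopologicalGroupoid X] [CompactSpace (Arr X)]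
    [T2Space (Arr X)] (u v : X) : Measure (u ⟶ v) :=
  if h : Nonempty (u ⟶ v) then
    Measure.map (fun g : u ⟶ u => g ≫ h.some) (Measure.haarMeasure ⊤)
  else 0

/-- The range fibre `G^u = r⁻¹(u)`: all arrows with range `u`. -/
structure RangeFibre (u : X) where
  /-- the source of the arrow -/
  {src : X}
  /-- the arrow itself -/
  hom : src ⟶ u

/-- An element of a range fibre as an arrow. -/
def RangeFibre.toArr {u : X} (x : RangeFibre u) : Arr X := ⟨x.hom⟩

instance rangeFibreTopology (u : X) : TopologicalSpace (RangeFibre u) :=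
  TopologicalSpace.induced RangeFibre.toArr inferInstance

instance rangeFibreMeasurableSpace (u : X) : MeasurableSpace (RangeFibre u) := borel _

instance rangeFibreBorelSpace (u : X) : BorelSpace (RangeFibre u) := ⟨rfl⟩

/-- A normalized continuous (left) Haar system `(λ^u)` of a compact groupoid: regular Borel
probability measures of full support on the range fibres, invariant under left translation, with
`u ↦ ∫ f dλ^u` continuous for every continuous function `f` on the groupoid. -/
structure NormalizedHaarSystem (X : Type*) [Groupoid X] [TopologicalSpace X]
    [TopologicalSpace (Arr X)] where
  measure : ∀ u : X, Measure (RangeFibre u)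
  regular : ∀ u, (measure u).Regular
  normalized : ∀ u, measure u Set.univ = 1
  full_support : ∀ u, (measure u).IsOpenPosMeasure
  left_invariant : ∀ {v w : X} (x : v ⟶ w),
    Measure.map (fun y : RangeFibre v => (⟨y.hom ≫ x⟩ : RangeFibre w)) (measure v) = measure w
  continuous_integral : ∀ f : C(Arr X, ℂ), Continuous fun u => ∫ y, f y.toArr ∂(measure u)

end Measures

/-! ### Representations on continuous Hilbert bundles -/

/-- A continuous field of Hilbert spaces over `X` with fibres `H u` (Godement, Dixmier–Douady), given
by its space of continuous sections. -/
structure HilbertBundle (X : Type*) [TopologicalSpace X] (H : X → Type*)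
    [∀ u, NormedAddCommGroup (H u)] [∀ u, InnerProductSpace ℂ (H u)]
    [∀ u, CompleteSpace (H u)] where
  sections : Submodule ℂ (∀ u, H u)
  dense : ∀ u, Dense ((fun ξ : ∀ u, H u => ξ u) '' (sections : Set (∀ u, H u)))
  continuous_norm : ∀ ξ ∈ sections, Continuous fun u => ‖ξ u‖
  locally_approximable : ∀ ζ : ∀ u, H u,
    (∀ u, ∀ ε > 0, ∃ ξ ∈ sections, ∀ᶠ w in 𝓝 u, ‖ζ w - ξ w‖ < ε) → ζ ∈ sections

/-- A continuous unitary representation of a topological groupoid on a Hilbert bundle: unitary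
operators `π(x) : H_{s(x)} → H_{r(x)}`, multiplicative, such that `x ↦ ⟨π(x) ξ_{s(x)}, η_{r(x)}⟩` is
continuous for all continuous sections `ξ`, `η`. -/
structure UnitaryRep (X : Type*) [Groupoid X] [TopologicalSpace X] [TopologicalSpace (Arr X)]
    (H : X → Type*) [∀ u, NormedAddCommGroup (H u)] [∀ u, InnerProductSpace ℂ (H u)]
    [∀ u, CompleteSpace (H u)] where
  bundle : HilbertBundle X H
  unitary : ∀ {u v : X}, (u ⟶ v) → (H u ≃ₗᵢ[ℂ] H v)
  unitary_id : ∀ (u : X) (ξ : H u), unitary (𝟙 u) ξ = ξ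
  unitary_comp : ∀ {u v w : X} (y : u ⟶ v) (x : v ⟶ w) (ξ : H u),
    unitary (y ≫ x) ξ = unitary x (unitary y ξ)
  continuous_coeff : ∀ ξ ∈ bundle.sections, ∀ η ∈ bundle.sections,
    Continuous fun x : Arr X => inner ℂ (unitary x.hom (ξ x.src)) (η x.tgt)

section Representations

variable {X : Type*} [Groupoid X] [TopologicalSpace X] [TopologicalSpace (Arr X)]
  {H K : X → Type*} [∀ u, NormedAddCommGroup (H u)] [∀ u, InnerProductSpace ℂ (H u)]
  [∀ u, CompleteSpace (H u)] [∀ u, NormedAddCommGroup (K u)] [∀ u, InnerProductSpace ℂ (K u)]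
  [∀ u, CompleteSpace (K u)]

/-- The bounded operator `π(x) : H_{s(x)} → H_{r(x)}`. -/
noncomputable def UnitaryRep.op (π : UnitaryRep X H) {u v : X} (x : u ⟶ v) : H u →L[ℂ] H v :=
  ((π.unitary x).toContinuousLinearEquiv : H u →L[ℂ] H v)

/-- An invariant subbundle: closed subspaces `M u ⊆ H u`, mapped into each other by the
representation, whose continuous sections (the continuous sections of `H` with values in `M`) are
dense in every fibre. -/
structure UnitaryRep.IsInvariantSubbundle (π : UnitaryRep X H) (M : ∀ u, Submodule ℂ (H u)) :
    Prop where
  isClosed : ∀ u, IsClosed (M u : Set (H u))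
  invariant : ∀ {u v : X} (x : u ⟶ v), ∀ ξ ∈ M u, π.op x ξ ∈ M v
  continuous : ∀ u, ∀ ζ ∈ M u, ∀ ε > 0, ∃ ξ ∈ π.bundle.sections,
    (∀ w, ξ w ∈ M w) ∧ ‖ξ u - ζ‖ < ε

/-- A representation is irreducible if it is nonzero and has no invariant subbundles besides `0`
and the whole bundle. -/
def UnitaryRep.IsIrreducible (π : UnitaryRep X H) : Prop :=
  (∃ u, Nontrivial (H u)) ∧
    ∀ M : ∀ u, Submodule ℂ (H u), π.IsInvariantSubbundle M → (∀ u, M u = ⊥) ∨ (∀ u, M u = ⊤)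

/-- Unitary equivalence: a fibrewise unitary isomorphism of Hilbert bundles that intertwines the two
representations. -/
def UnitaryRep.IsEquivalent (π : UnitaryRep X H) (σ : UnitaryRep X K) : Prop :=
  ∃ U : ∀ u, H u ≃ₗᵢ[ℂ] K u,
    (∀ {u v : X} (x : u ⟶ v) (ξ : H u), U v (π.op x ξ) = σ.op x (U u ξ)) ∧
    ∀ ξ : ∀ u, H u, ξ ∈ π.bundle.sections ↔ (fun u => U u (ξ u)) ∈ σ.bundle.sections

/-- A bundle of bounded operators `A u : H u → K u` intertwines `π` and `σ` if
`A_{r(x)} π(x) = σ(x) A_{s(x)}` for every arrow `x`. -/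
def UnitaryRep.Intertwines (π : UnitaryRep X H) (σ : UnitaryRep X K)
    (A : ∀ u, H u →L[ℂ] K u) : Prop :=
  ∀ {u v : X} (x : u ⟶ v), A v ∘L π.op x = σ.op x ∘L A u

end Representations

/-- The trace of a bounded operator on a (finite-dimensional) Hilbert space. -/
noncomputable def tr {V : Type*} [NormedAddCommGroup V] [InnerProductSpace ℂ V]
    (T : V →L[ℂ] V) : ℂ :=
  LinearMap.trace ℂ V (T : V →ₗ[ℂ] V)

/-- `f` is integrable and its (Bochner) integral is `a`. -/
def HasIntegral {α V : Type*} [MeasurableSpace α] [NormedAddCommGroup V] [NormedSpace ℝ V]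
    (μ : Measure α) (f : α → V) (a : V) : Prop :=
  Integrable f μ ∧ ∫ x, f x ∂μ = a

end GroupoidDuality

/-! The theorem reduces to the classical Schur relations for one compact isotropy group.

Orbits are closed by compactness. If an irreducible representation lived on two orbits, Urysohn
functions vanishing on one of them would produce a proper invariant subbundle; so it lives on one
orbit (`IsIrreducible.nonempty_hom`). This orbit is also open, being the support of the bundle. An
operator commuting with the isotropy at `u` can therefore be translated along the orbit and extended
by zero (`extend`), and the extension preserves continuous sections (`extend_mem_sections`).
Extending a projection shows that the isotropy representation is irreducible
(`IsIrreducible.isotropy`); extending a unitary intertwiner turns isotropy equivalence into bundle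
equivalence (`IsIrreducible.isEquivalent_of_ne_zero`).

On the isotropy group, averaging a rank-one operator gives a nonzero compact self-adjoint
intertwiner, whence finite dimension; Schur's lemma follows. The average of `τ(g) A ρ(g⁻¹)` is an
intertwiner, so it is zero or the scalar fixed by its trace, and one arrow `u ⟶ v` transports this
to `homMeasure u v`. The other relations are linear consequences: rank-one `A` gives the tensor
relation, contracting it gives the operator-valued one, and traces and adjoints give the rest. Over
a range fibre the integrand for an intertwiner is constant, so Schur's lemma suffices. -/

namespace GroupoidDuality

/-! ### Weak continuity and norm continuity -/

section Hilbert

variable {α V : Type*} [TopologicalSpace α] [NormedAddCommGroup V] [InnerProductSpace ℂ V]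

/-- A map into a Hilbert space is continuous if its norm and its inner products with a dense set of
vectors are continuous. -/
theorem continuous_of_norm_of_inner {f : α → V} {D : Set V} (hD : Dense D)
    (hn : Continuous fun x => ‖f x‖) (hi : ∀ η ∈ D, Continuous fun x => inner ℂ (f x) η) :
    Continuous f := by
  refine continuous_iff_continuousAt.2 fun a => Metric.tendsto_nhds.2 fun ε hε => ?_
  obtain ⟨η, hη, hd⟩ := hD.exists_dist_lt (f a) (half_pos hε)
  -- The distance to `η` is a function of the norm and of one inner product only.
  have hc : Continuous fun x => ‖f x - η‖ := by
    have : (fun x => ‖f x - η‖) =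
        fun x => √(‖f x‖ ^ 2 - 2 * (inner ℂ (f x) η).re + ‖η‖ ^ 2) := by
      funext x
      rw [← Real.sqrt_sq (norm_nonneg (f x - η)), @norm_sub_sq ℂ]
      rfl
    rw [this]
    have := Complex.continuous_re.comp (hi η hη)
    exact (((hn.pow 2).sub (continuous_const.mul this)).add continuous_const).sqrt
  have hlt : ∀ᶠ x in 𝓝 a, ‖f x - η‖ < ε / 2 :=
    hc.continuousAt.eventually_lt continuousAt_const (by rwa [← dist_eq_norm])
  filter_upwards [hlt] with x hx
  calc dist (f x) (f a) ≤ dist (f x) η + dist (f a) η := dist_triangle_right _ _ _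
    _ < ε := by rw [dist_eq_norm (f x)]; linarith

end Hilbert

/-! ### Continuous sections of a Hilbert bundle -/

section Sections

variable {X : Type*} [TopologicalSpace X] {H : X → Type*} [∀ u, NormedAddCommGroup (H u)]
  [∀ u, InnerProductSpace ℂ (H u)] [∀ u, CompleteSpace (H u)]

theorem HilbertBundle.exists_norm_sub_lt (S : HilbertBundle X H) (u : X) (ζ : H u) {ε : ℝ}
    (hε : 0 < ε) : ∃ ξ ∈ S.sections, ‖ξ u - ζ‖ < ε := by
  obtain ⟨_, ⟨ξ, hξ, rfl⟩, h⟩ := (S.dense u).exists_dist_lt ζ hε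
  exact ⟨ξ, hξ, by rwa [dist_comm, dist_eq_norm] at h⟩

/-- A field of vectors with continuous norm and continuous inner products with all continuous
sections is itself a continuous section. -/
theorem HilbertBundle.mem_sections_of_inner (S : HilbertBundle X H) {ζ : ∀ u, H u}
    (hn : Continuous fun u => ‖ζ u‖)
    (hi : ∀ η ∈ S.sections, Continuous fun u => inner ℂ (ζ u) (η u)) : ζ ∈ S.sections := by
  refine S.locally_approximable ζ fun u ε hε => ?_
  obtain ⟨ξ, hξ, h⟩ := S.exists_norm_sub_lt u (ζ u) hε
  refine ⟨ξ, hξ, ?_⟩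
  have hc : Continuous fun w => ‖ζ w - ξ w‖ := by
    have : (fun x => ‖ζ x - ξ x‖) =
        fun x => √(‖ζ x‖ ^ 2 - 2 * (inner ℂ (ζ x) (ξ x)).re + ‖ξ x‖ ^ 2) := by
      funext x
      rw [← Real.sqrt_sq (norm_nonneg (ζ x - ξ x)), @norm_sub_sq ℂ]
      rfl
    rw [this]
    have := Complex.continuous_re.comp (hi ξ hξ)
    exact (((hn.pow 2).sub (continuous_const.mul this)).add
      ((S.continuous_norm ξ hξ).pow 2)).sqrt
  exact hc.continuousAt.eventually_lt continuousAt_const (by rwa [norm_sub_rev])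

/-- Near `u` the constant multiple `f u • ξ` approximates the field, so local completeness upgrades
the complex subspace of sections to a module over continuous real functions. This permits Urysohn
cut-offs. -/
theorem HilbertBundle.smul_mem_sections (S : HilbertBundle X H) {ξ : ∀ u, H u}
    (hξ : ξ ∈ S.sections) (f : C(X, ℝ)) : (fun u => (f u : ℂ) • ξ u) ∈ S.sections := by
  refine S.locally_approximable _ fun u ε hε =>
    ⟨(f u : ℂ) • ξ, S.sections.smul_mem _ hξ, ?_⟩
  have hc : Continuous fun w => |f w - f u| * ‖ξ w‖ :=
    (f.continuous.sub continuous_const).abs.mul (S.continuous_norm ξ hξ)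
  have : ∀ᶠ w in 𝓝 u, |f w - f u| * ‖ξ w‖ < ε :=
    hc.continuousAt.eventually_lt continuousAt_const (by simpa)
  filter_upwards [this] with w hw
  rw [Pi.smul_apply, ← sub_smul, norm_smul, ← Complex.ofReal_sub, Complex.norm_real]
  exact hw

/-- The support of a Hilbert bundle is open. -/
theorem HilbertBundle.isOpen_support (S : HilbertBundle X H) :
    IsOpen {u : X | Nontrivial (H u)} := by
  refine isOpen_iff_mem_nhds.2 fun u (hu : Nontrivial (H u)) => ?_
  obtain ⟨ζ, hζ⟩ := exists_ne (0 : H u)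
  obtain ⟨ξ, hξ, h⟩ := S.exists_norm_sub_lt u ζ (norm_pos_iff.2 hζ)
  have h0 : 0 < ‖ξ u‖ := norm_pos_iff.2 fun h0 => by simp [h0] at h
  filter_upwards [(S.continuous_norm ξ hξ).continuousAt.eventually (lt_mem_nhds h0)] with w hw
  exact ⟨ξ w, 0, norm_pos_iff.1 hw⟩

end Sections

/-! ### Orbits and range fibres of a compact groupoid -/

section Topology

variable {X : Type*} [Groupoid X] [TopologicalSpace (Arr X)]

theorem continuous_rangeFibre_toArr (u : X) :
    Continuous (RangeFibre.toArr : RangeFibre u → Arr X) :=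
  continuous_induced_dom

theorem continuous_toRangeFibre (u v : X) :
    Continuous fun x : u ⟶ v => (⟨x⟩ : RangeFibre v) :=
  continuous_induced_rng.2 (continuous_toArr u v)

variable [TopologicalSpace X] [TopologicalGroupoid X]

theorem continuous_rangeFibre_src (u : X) : Continuous fun x : RangeFibre u => x.src :=
  TopologicalGroupoid.continuous_src.comp (continuous_rangeFibre_toArr u)

theorem t2Space_units [T2Space (Arr X)] : T2Space X :=
  T2Space.of_injective_continuous (f := fun u : X => (⟨𝟙 u⟩ : Arr X))
    (fun _ _ h => congrArg Arr.src h) TopologicalGroupoid.continuous_unit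

theorem compactSpace_units [CompactSpace (Arr X)] : CompactSpace X := by
  have hs : Function.Surjective fun x : Arr X => x.src := fun u => ⟨⟨𝟙 u⟩, rfl⟩
  refine ⟨?_⟩
  rw [← hs.range_eq]
  exact isCompact_range TopologicalGroupoid.continuous_src

variable [CompactSpace (Arr X)] [T2Space (Arr X)]

theorem compactSpace_rangeFibre (u : X) : CompactSpace (RangeFibre u) := by
  have := t2Space_units (X := X)
  have hinj : Function.Injective (RangeFibre.toArr : RangeFibre u → Arr X) := by
    rintro ⟨x⟩ ⟨y⟩ h
    simp only [RangeFibre.toArr, Arr.mk.injEq] at h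
    obtain ⟨rfl, -, h⟩ := h
    rw [eq_of_heq h]
  refine (Topology.IsClosedEmbedding.mk ⟨⟨rfl⟩, hinj⟩ ?_).compactSpace
  have hrange : Set.range (RangeFibre.toArr : RangeFibre u → Arr X) =
      (fun x : Arr X => x.tgt) ⁻¹' {u} := by
    ext x
    constructor
    · rintro ⟨y, rfl⟩
      exact rfl
    · obtain ⟨x⟩ := x
      rintro rfl
      exact ⟨⟨x⟩, rfl⟩
  rw [hrange]
  exact isClosed_singleton.preimage TopologicalGroupoid.continuous_tgt

theorem isClosedMap_rangeFibre_src (u : X) : IsClosedMap fun x : RangeFibre u => x.src := by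
  have := t2Space_units (X := X)
  have := compactSpace_rangeFibre u
  exact (continuous_rangeFibre_src u).isClosedMap

theorem isClosed_orbit (u : X) : IsClosed {w : X | Nonempty (w ⟶ u)} := by
  convert (isClosedMap_rangeFibre_src u).isClosed_range using 1
  ext w
  exact ⟨fun ⟨x⟩ => ⟨⟨x⟩, rfl⟩, by rintro ⟨x, rfl⟩; exact ⟨x.hom⟩⟩

/-- A function on the unit space that vanishes off an open orbit is continuous if its pullback to
a range fibre over that orbit is. -/
theorem continuous_of_continuous_comp_src {Y : Type*} [TopologicalSpace Y] [Zero Y] {u : X}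
    (hu : IsOpen {w : X | Nonempty (w ⟶ u)}) {f : X → Y}
    (h0 : ∀ w, IsEmpty (w ⟶ u) → f w = 0) (hf : Continuous fun x : RangeFibre u => f x.src) :
    Continuous f := by
  refine continuous_iff_isClosed.2 fun C hC => ?_
  have h1 := isClosedMap_rangeFibre_src u _ (hC.preimage hf)
  -- On the orbit the preimage is a closed image; off the orbit, which is a closed set, it is
  -- everything or nothing according to whether `0 ∈ C`.
  have key : f ⁻¹' C = ((fun x : RangeFibre u => x.src) '' ((fun x => f x.src) ⁻¹' C)) ∪
      ({w : X | Nonempty (w ⟶ u)}ᶜ ∩ {_w | (0 : Y) ∈ C}) := by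
    ext w
    constructor
    · intro hw
      by_cases h : Nonempty (w ⟶ u)
      · exact Or.inl ⟨⟨h.some⟩, hw, rfl⟩
      · refine Or.inr ⟨h, ?_⟩
        rw [← h0 w (not_nonempty_iff.1 h)]
        exact hw
    · rintro (⟨x, hx, rfl⟩ | ⟨h, hw⟩)
      · exact hx
      · rw [Set.mem_preimage, h0 w (not_nonempty_iff.1 h)]
        exact hw
  rw [key]
  exact h1.union (hu.isClosed_compl.inter isClosed_const)

end Topology

/-! ### Algebra and continuity of unitary representations -/

section Representations

variable {X : Type*} [Groupoid X] [TopologicalSpace X] [TopologicalSpace (Arr X)]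
  {H : X → Type*} [∀ u, NormedAddCommGroup (H u)] [∀ u, InnerProductSpace ℂ (H u)]
  [∀ u, CompleteSpace (H u)] (π : UnitaryRep X H)

namespace UnitaryRep

@[simp] theorem norm_op {u v : X} (x : u ⟶ v) (ξ : H u) : ‖π.op x ξ‖ = ‖ξ‖ :=
  (π.unitary x).norm_map ξ

@[simp] theorem op_id (u : X) (ξ : H u) : π.op (𝟙 u) ξ = ξ := π.unitary_id u ξ

theorem op_comp_apply {u v w : X} (y : u ⟶ v) (x : v ⟶ w) (ξ : H u) :
    π.op (y ≫ x) ξ = π.op x (π.op y ξ) := π.unitary_comp y x ξ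

theorem op_comp {u v w : X} (y : u ⟶ v) (x : v ⟶ w) : π.op (y ≫ x) = π.op x ∘L π.op y :=
  ContinuousLinearMap.ext fun ξ => π.op_comp_apply y x ξ

@[simp] theorem op_inv_op {u v : X} (x : u ⟶ v) (ξ : H u) :
    π.op (Groupoid.inv x) (π.op x ξ) = ξ := by
  rw [← op_comp_apply, Groupoid.comp_inv, op_id]

@[simp] theorem op_op_inv {u v : X} (x : u ⟶ v) (ξ : H v) :
    π.op x (π.op (Groupoid.inv x) ξ) = ξ := by
  rw [← op_comp_apply, Groupoid.inv_comp, op_id]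

theorem inner_op_op {u v : X} (x : u ⟶ v) (ξ η : H u) :
    inner ℂ (π.op x ξ) (π.op x η) = inner ℂ ξ η :=
  (π.unitary x).inner_map_map ξ η

theorem inner_op_left {u v : X} (x : u ⟶ v) (ξ : H u) (η : H v) :
    inner ℂ (π.op x ξ) η = inner ℂ ξ (π.op (Groupoid.inv x) η) := by
  rw [← π.inner_op_op x ξ, op_op_inv]

theorem inner_op_inv_left {u v : X} (x : u ⟶ v) (ξ : H v) (η : H u) :
    inner ℂ (π.op (Groupoid.inv x) ξ) η = inner ℂ ξ (π.op x η) := by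
  rw [← π.inner_op_op x _ η, op_op_inv]

theorem adjoint_op {u v : X} (x : u ⟶ v) :
    ContinuousLinearMap.adjoint (π.op x) = π.op (Groupoid.inv x) :=
  ((ContinuousLinearMap.eq_adjoint_iff _ _).2 fun ξ η => π.inner_op_inv_left x ξ η).symm

theorem nontrivial_of_hom (π : UnitaryRep X H) {u v : X} (x : u ⟶ v) [Nontrivial (H u)] : Nontrivial (H v) :=
  (π.unitary x).symm.toEquiv.nontrivial

/-- Translating the values of a continuous section into a fixed fibre is norm continuous. -/
theorem continuous_op_section {ξ : ∀ u, H u} (hξ : ξ ∈ π.bundle.sections) (u : X)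
    [TopologicalGroupoid X] : Continuous fun x : RangeFibre u => π.op x.hom (ξ x.src) := by
  refine continuous_of_norm_of_inner (π.bundle.dense u) ?_ ?_
  · simp only [norm_op]
    exact (π.bundle.continuous_norm ξ hξ).comp (continuous_rangeFibre_src u)
  · rintro _ ⟨η, hη, rfl⟩
    exact (π.continuous_coeff ξ hξ η hη).comp (continuous_rangeFibre_toArr u)

/-- Section values are dense in the fibre, and unitarity makes the approximation of `ζ` uniform in
`x`. -/
theorem continuous_op_apply [TopologicalGroupoid X] (u v : X) (ζ : H u) :
    Continuous fun x : u ⟶ v => π.op x ζ := by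
  refine continuous_iff_continuousAt.2 fun a => Metric.tendsto_nhds.2 fun ε hε => ?_
  obtain ⟨ξ, hξ, h⟩ := π.bundle.exists_norm_sub_lt u ζ (ε := ε / 3) (by positivity)
  have hc : Continuous fun x : u ⟶ v => π.op x (ξ u) :=
    (π.continuous_op_section hξ v).comp (continuous_toRangeFibre u v)
  have hd : ∀ x : u ⟶ v, dist (π.op x ζ) (π.op x (ξ u)) < ε / 3 := fun x => by
    rwa [dist_eq_norm, ← map_sub, norm_op, norm_sub_rev]
  filter_upwards [Metric.tendsto_nhds.1 (hc.tendsto a) (ε / 3) (by positivity)] with x hx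
  have h1 := dist_triangle4 (π.op x ζ) (π.op x (ξ u)) (π.op a (ξ u)) (π.op a ζ)
  have h2 := hd x
  have h3 := hd a
  rw [dist_comm] at h3
  linarith

end UnitaryRep

end Representations

/-! ### Extending isotropy intertwiners along an orbit -/

section Extend

variable {X : Type*} [Groupoid X] [TopologicalSpace X] [TopologicalSpace (Arr X)]
  {E F : X → Type*}
  [∀ u, NormedAddCommGroup (E u)] [∀ u, InnerProductSpace ℂ (E u)] [∀ u, CompleteSpace (E u)]
  [∀ u, NormedAddCommGroup (F u)] [∀ u, InnerProductSpace ℂ (F u)] [∀ u, CompleteSpace (F u)]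
  {τ : UnitaryRep X E} {ρ : UnitaryRep X F}

namespace UnitaryRep

/-- An operator between the fibres at `u` intertwines the representations of the isotropy group. -/
def IsotropyIntertwines (ρ : UnitaryRep X F) (τ : UnitaryRep X E) {u : X} (B : F u →L[ℂ] E u) :
    Prop :=
  ∀ g : u ⟶ u, ∀ ξ, B (ρ.op g ξ) = τ.op g (B ξ)

open Classical in
/-- The extension of an intertwiner of isotropy representations at `u` to the whole bundle, by
translation on the orbit of `u` and by `0` off this orbit. -/
noncomputable def extend (ρ : UnitaryRep X F) (τ : UnitaryRep X E) {u : X} (B : F u →L[ℂ] E u)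
    (w : X) : F w →L[ℂ] E w :=
  if h : Nonempty (w ⟶ u) then τ.op (Groupoid.inv h.some) ∘L B ∘L ρ.op h.some else 0

variable {u : X} {B : F u →L[ℂ] E u}

theorem extend_of_isEmpty {w : X} (h : IsEmpty (w ⟶ u)) : extend ρ τ B w = 0 :=
  dif_neg (not_nonempty_iff.2 h)

/-- Two arrows `w ⟶ u` differ by an isotropy element, which `B` respects, so the choice in `extend`
is immaterial. -/
theorem extend_apply (hB : IsotropyIntertwines ρ τ B) {w : X} (x : w ⟶ u) (ξ : F w) :
    extend ρ τ B w ξ = τ.op (Groupoid.inv x) (B (ρ.op x ξ)) := by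
  have h : Nonempty (w ⟶ u) := ⟨x⟩
  rw [extend, dif_pos h]
  simp only [ContinuousLinearMap.comp_apply]
  have key : ρ.op x ξ = ρ.op (Groupoid.inv h.some ≫ x) (ρ.op h.some ξ) := by
    rw [op_comp_apply, op_inv_op]
  rw [key, hB, op_comp_apply, op_inv_op]

theorem extend_op (hB : IsotropyIntertwines ρ τ B) {v w : X} (x : v ⟶ w) (ξ : F v) :
    extend ρ τ B w (ρ.op x ξ) = τ.op x (extend ρ τ B v ξ) := by
  by_cases h : Nonempty (w ⟶ u)
  · obtain ⟨y⟩ := h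
    rw [extend_apply hB y, extend_apply hB (x ≫ y), ← op_comp_apply ρ]
    have := τ.op_op_inv (x ≫ y) (B (ρ.op (x ≫ y) ξ))
    rw [op_comp_apply τ] at this
    rw [← τ.op_inv_op y (τ.op x _), this]
  · have h' : IsEmpty (v ⟶ u) := ⟨fun y => h ⟨Groupoid.inv x ≫ y⟩⟩
    rw [extend_of_isEmpty (not_nonempty_iff.1 h), extend_of_isEmpty h']
    simp

theorem IsEquivalent.symm (h : ρ.IsEquivalent τ) : τ.IsEquivalent ρ := by
  obtain ⟨U, hU, hs⟩ := h
  refine ⟨fun u => (U u).symm, fun {u v} x ξ => ?_, fun ξ => ?_⟩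
  · rw [LinearIsometryEquiv.symm_apply_eq, hU, LinearIsometryEquiv.apply_symm_apply]
  · rw [hs]
    simp

end UnitaryRep

end Extend

/-! ### Irreducibility: one orbit, irreducible isotropy -/

section Irreducible

variable {X : Type*} [Groupoid X] [TopologicalSpace X] [TopologicalSpace (Arr X)]
  [TopologicalGroupoid X] [CompactSpace (Arr X)] [T2Space (Arr X)]
  {E F : X → Type*}
  [∀ u, NormedAddCommGroup (E u)] [∀ u, InnerProductSpace ℂ (E u)] [∀ u, CompleteSpace (E u)]
  [∀ u, NormedAddCommGroup (F u)] [∀ u, InnerProductSpace ℂ (F u)] [∀ u, CompleteSpace (F u)]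
  {τ : UnitaryRep X E} {ρ : UnitaryRep X F}

namespace UnitaryRep

/-- An irreducible representation is supported on a single orbit. -/
theorem IsIrreducible.nonempty_hom (hτ : τ.IsIrreducible) {u v : X} (hu : Nontrivial (E u))
    (hv : Nontrivial (E v)) : Nonempty (u ⟶ v) := by
  classical
  by_contra hne
  have := t2Space_units (X := X)
  have := compactSpace_units (X := X)
  -- The orbit of `v` is killed and all other fibres are kept; this would be proper if `u` lay on a
  -- different orbit.
  let M : ∀ w, Submodule ℂ (E w) := fun w => if Nonempty (w ⟶ v) then ⊥ else ⊤
  have hM1 : ∀ {w}, Nonempty (w ⟶ v) → M w = ⊥ := fun h => if_pos h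
  have hM2 : ∀ {w}, ¬ Nonempty (w ⟶ v) → M w = ⊤ := fun h => if_neg h
  have hM : τ.IsInvariantSubbundle M := by
    refine ⟨fun w => ?_, fun {a b} x ξ hξ => ?_, fun w ζ hζ ε hε => ?_⟩
    · by_cases h : Nonempty (w ⟶ v)
      · rw [hM1 h]; exact isClosed_singleton
      · rw [hM2 h]; exact isClosed_univ
    · by_cases h : Nonempty (a ⟶ v)
      · rw [hM1 h, Submodule.mem_bot] at hξ
        rw [hξ, map_zero]
        exact zero_mem _
      · rw [hM2 fun ⟨y⟩ => h ⟨x ≫ y⟩]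
        exact Submodule.mem_top
    · by_cases h : Nonempty (w ⟶ v)
      · rw [hM1 h, Submodule.mem_bot] at hζ
        exact ⟨0, zero_mem _, fun _ => zero_mem _, by simpa [hζ] using hε⟩
      · obtain ⟨f, hf0, hf1, -⟩ := exists_continuous_zero_one_of_isClosed (isClosed_orbit v)
          (isClosed_singleton (x := w)) (Set.disjoint_singleton_right.2 h)
        obtain ⟨ξ, hξ, hd⟩ := τ.bundle.exists_norm_sub_lt w ζ hε
        refine ⟨_, τ.bundle.smul_mem_sections hξ f, fun b => ?_, ?_⟩
        · by_cases hb : Nonempty (b ⟶ v)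
          · have : f b = 0 := hf0 hb
            simp [this]
          · rw [hM2 hb]
            exact Submodule.mem_top
        · have : f w = 1 := hf1 rfl
          simpa [this] using hd
  rcases hτ.2 M hM with h | h
  · exact top_ne_bot ((hM2 hne).symm.trans (h u))
  · exact bot_ne_top ((hM1 ⟨𝟙 v⟩).symm.trans (h v))

theorem IsIrreducible.subsingleton_of_isEmpty (hτ : τ.IsIrreducible) {u w : X}
    (hu : Nontrivial (E u)) (h : IsEmpty (w ⟶ u)) : Subsingleton (E w) :=
  not_nontrivial_iff_subsingleton.1 fun hw => h.elim (hτ.nonempty_hom hw hu).some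

theorem IsIrreducible.isOpen_orbit (hτ : τ.IsIrreducible) {u : X} (hu : Nontrivial (E u)) :
    IsOpen {w : X | Nonempty (w ⟶ u)} := by
  convert τ.bundle.isOpen_support using 1
  ext w
  exact ⟨fun ⟨x⟩ => τ.nontrivial_of_hom (Groupoid.inv x), fun hw => hτ.nonempty_hom hw hu⟩

variable {u : X} {B : F u →L[ℂ] E u}

/-- The extended intertwiner maps continuous sections to continuous sections. -/
theorem extend_mem_sections (hB : IsotropyIntertwines ρ τ B)
    (hu : IsOpen {w : X | Nonempty (w ⟶ u)}) {ξ : ∀ w, F w} (hξ : ξ ∈ ρ.bundle.sections) :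
    (fun w => extend ρ τ B w (ξ w)) ∈ τ.bundle.sections := by
  have hc : Continuous fun x : RangeFibre u => B (ρ.op x.hom (ξ x.src)) :=
    B.continuous.comp (ρ.continuous_op_section hξ u)
  refine τ.bundle.mem_sections_of_inner ?_ fun η hη => ?_
  · refine continuous_of_continuous_comp_src hu (fun w h => ?_) ?_
    · simp [extend_of_isEmpty h]
    -- The unitary `τ.op (Groupoid.inv x)` drops out of the norm and moves across the inner product,
    -- so both pullbacks take place in the fixed fibre at `u`.
    · convert hc.norm using 2 with x
      rw [extend_apply hB x.hom, norm_op]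
  · refine continuous_of_continuous_comp_src hu (fun w h => ?_) ?_
    · simp [extend_of_isEmpty h]
    · convert hc.inner (𝕜 := ℂ) (τ.continuous_op_section hη u) using 2 with x
      rw [extend_apply hB x.hom, inner_op_inv_left]

/-- The isotropy representations of an irreducible representation are irreducible. -/
theorem IsIrreducible.isotropy (hτ : τ.IsIrreducible) {u : X} (N : Submodule ℂ (E u))
    (hN : IsClosed (N : Set (E u))) (hinv : ∀ g : u ⟶ u, ∀ ξ ∈ N, τ.op g ξ ∈ N) :
    N = ⊥ ∨ N = ⊤ := by
  rcases subsingleton_or_nontrivial (E u) with hs | hu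
  · exact Or.inl (Subsingleton.elim _ _)
  have : CompleteSpace N := hN.completeSpace_coe
  let P : E u →L[ℂ] E u := N.starProjection
  have hPmem : ∀ ξ, P ξ ∈ N := fun ξ => Submodule.starProjection_apply_mem _ _
  have hPid : ∀ ξ ∈ N, P ξ = ξ := fun ξ hξ => Submodule.starProjection_eq_self_iff.2 hξ
  have hP : IsotropyIntertwines τ τ P := fun g ξ => by
    refine Submodule.eq_starProjection_of_mem_of_inner_eq_zero (hinv g _ (hPmem ξ))
      fun η hη => ?_
    rw [← map_sub, inner_op_left]
    exact Submodule.starProjection_inner_eq_zero ξ _ (hinv _ _ hη)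
  -- Off the orbit the infimum is empty and gives `⊤`, which is harmless since those fibres are
  -- zero.
  let M : ∀ w, Submodule ℂ (E w) := fun w =>
    ⨅ x : w ⟶ u, N.comap (τ.op x : E w →ₗ[ℂ] E u)
  have hM : ∀ {w} {ξ : E w}, ξ ∈ M w ↔ ∀ x : w ⟶ u, τ.op x ξ ∈ N := by
    simp [M, Submodule.mem_iInf]
  have hMu : M u = N := by
    ext ξ
    refine hM.trans ⟨fun h => by simpa using h (𝟙 u), fun h x => hinv x ξ h⟩
  have hsub : τ.IsInvariantSubbundle M := by
    refine ⟨fun w => ?_, fun x ξ hξ => hM.2 fun y => ?_, fun w ζ hζ ε hε => ?_⟩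
    · have : (M w : Set (E w)) = ⋂ x : w ⟶ u, τ.op x ⁻¹' (N : Set (E u)) := by
        ext ξ
        simpa using hM
      rw [this]
      exact isClosed_iInter fun x => hN.preimage (τ.op x).continuous
    · rw [← op_comp_apply]
      exact hM.1 hξ _
    · by_cases h : Nonempty (w ⟶ u)
      · obtain ⟨x⟩ := h
        obtain ⟨ξ, hξ, hd⟩ := τ.bundle.exists_norm_sub_lt w ζ hε
        -- The extended projection sends sections into `M`, fixes `ζ`, and is a contraction, so the
        -- approximation survives.
        refine ⟨_, extend_mem_sections hP (hτ.isOpen_orbit hu) hξ, fun b => hM.2 fun y => ?_, ?_⟩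
        · rw [extend_apply hP y, op_op_inv]
          exact hPmem _
        · have hfix : extend τ τ P w ζ = ζ := by
            rw [extend_apply hP x, hPid _ (hM.1 hζ x), op_inv_op]
          rw [← hfix, ← map_sub, extend_apply hP x, norm_op]
          refine lt_of_le_of_lt (N.norm_starProjection_apply_le _) ?_
          rwa [norm_op]
      · have := hτ.subsingleton_of_isEmpty hu (not_nonempty_iff.1 h)
        refine ⟨0, zero_mem _, fun _ => zero_mem _, ?_⟩
        rw [Subsingleton.elim ζ 0]
        simpa using hε
  rw [← hMu]
  exact (hτ.2 M hsub).imp (fun h => h u) fun h => h u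

end UnitaryRep

end Irreducible

/-! ### Averaging over isotropy groups and Schur's lemma -/

section IsotropyHaar

variable {X : Type*} [Groupoid X] [TopologicalSpace X] [TopologicalSpace (Arr X)]
  [TopologicalGroupoid X] [CompactSpace (Arr X)] [T2Space (Arr X)]

/-- The Haar probability measure of an isotropy group. -/
noncomputable abbrev isotropyHaar (u : X) : Measure (u ⟶ u) := Measure.haarMeasure ⊤

instance isotropyHaar_isProbabilityMeasure (u : X) : IsProbabilityMeasure (isotropyHaar u) :=
  ⟨Measure.haarMeasure_self⟩

/-- A right translate is again a Haar probability measure, so uniqueness applies. Right invariance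
is the one needed: the group law is `g ≫ k`, which acts as `τ(k)τ(g)`. -/
instance isotropyHaar_isMulRightInvariant (u : X) :
    (isotropyHaar u).IsMulRightInvariant where
  map_mul_right_eq_self g := by
    have : IsProbabilityMeasure ((isotropyHaar u).map (· * g)) :=
      Measure.isProbabilityMeasure_map (measurable_mul_const g).aemeasurable
    exact Measure.isHaarMeasure_eq_of_isProbabilityMeasure _ _

theorem integrable_isotropyHaar {V : Type*} [NormedAddCommGroup V] {u : X} {f : (u ⟶ u) → V}
    (hf : Continuous f) : Integrable f (isotropyHaar u) :=
  hf.integrable_of_hasCompactSupport (HasCompactSupport.of_compactSpace f)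

variable {E F : X → Type*}
  [∀ u, NormedAddCommGroup (E u)] [∀ u, InnerProductSpace ℂ (E u)] [∀ u, CompleteSpace (E u)]
  [∀ u, NormedAddCommGroup (F u)] [∀ u, InnerProductSpace ℂ (F u)] [∀ u, CompleteSpace (F u)]
  {τ : UnitaryRep X E} {ρ : UnitaryRep X F}

namespace UnitaryRep

/-- The average of an equivariant family of operators over the isotropy group is an intertwiner. -/
theorem isotropyIntertwines_integral {u : X} {Φ : (u ⟶ u) → F u →L[ℂ] E u}
    (hΦ : Integrable Φ (isotropyHaar u))
    (h : ∀ g k ξ, Φ (g ≫ k) (ρ.op k ξ) = τ.op k (Φ g ξ)) :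
    IsotropyIntertwines ρ τ (∫ g, Φ g ∂(isotropyHaar u)) := fun k ξ => by
  rw [ContinuousLinearMap.integral_apply hΦ, ContinuousLinearMap.integral_apply hΦ,
    ← ContinuousLinearMap.integral_comp_comm _ (hΦ.apply_continuousLinearMap ξ),
    ← integral_mul_right_eq_self _ k]
  exact integral_congr_ae (.of_forall fun g => h g k ξ)

/-- An eigenspace of an intertwiner is closed, isotropy-invariant and nonzero. -/
theorem IsIrreducible.eigenspace_eq_top (hτ : τ.IsIrreducible) {u : X} {B : E u →L[ℂ] E u}
    (hB : IsotropyIntertwines τ τ B) {c : ℂ}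
    (hc : Module.End.HasEigenvalue (B : Module.End ℂ (E u)) c) :
    Module.End.eigenspace (B : Module.End ℂ (E u)) c = ⊤ := by
  have hmem : ∀ ζ, ζ ∈ Module.End.eigenspace (B : Module.End ℂ (E u)) c ↔ B ζ = c • ζ :=
    fun ζ => Module.End.mem_eigenspace_iff
  refine (hτ.isotropy _ ?_ fun g ζ hζ => ?_).resolve_left hc
  · convert isClosed_eq B.continuous (continuous_const_smul c) using 1
    ext ζ
    exact hmem ζ
  · rw [hmem] at hζ ⊢
    rw [hB, hζ, map_smul]

/-- The fibres of an irreducible representation are finite-dimensional. -/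
theorem IsIrreducible.finiteDimensional (hτ : τ.IsIrreducible) (u : X) :
    FiniteDimensional ℂ (E u) := by
  rcases subsingleton_or_nontrivial (E u) with hs | hu
  · infer_instance
  obtain ⟨ξ, hξ⟩ := exists_ne (0 : E u)
  let Φ : (u ⟶ u) → E u →L[ℂ] E u := fun g => InnerProductSpace.rankOne ℂ (τ.op g ξ) (τ.op g ξ)
  have hc := τ.continuous_op_apply u u ξ
  have hΦc : Continuous Φ :=
    ((ContinuousLinearMap.toSpanSingletonCLE (𝕜 := ℂ) (E := E u)).continuous.comp hc).clm_comp
      ((innerSL ℂ).continuous.comp hc)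
  have hΦ := integrable_isotropyHaar hΦc
  let T := ∫ g, Φ g ∂(isotropyHaar u)
  have hT : IsotropyIntertwines τ τ T := isotropyIntertwines_integral hΦ fun g k ζ => by
    simp only [Φ, InnerProductSpace.rankOne_apply, map_smul, op_comp_apply, inner_op_op]
  have hcomp : IsCompactOperator T := by
    refine Convex.integral_mem (s := {T : E u →L[ℂ] E u | IsCompactOperator T})
      ((compactOperator (RingHom.id ℂ) (E u) (E u)).restrictScalars ℝ).convex
      isClosed_setOfPred_isCompactOperator (.of_forall fun g => ?_) hΦ
    exact (isCompactOperator_of_locallyCompactSpace_dom (innerSL ℂ (τ.op g ξ))).clm_comp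
      (ContinuousLinearMap.toSpanSingleton ℂ (τ.op g ξ))
  have hsa : IsSelfAdjoint T :=
    Convex.integral_mem (s := {T : E u →L[ℂ] E u | IsSelfAdjoint T})
      (selfAdjoint.submodule ℝ (E u →L[ℂ] E u)).convex
      (isClosed_eq continuous_star continuous_id)
      (.of_forall fun g => (InnerProductSpace.isPositive_rankOne_self _).isSelfAdjoint) hΦ
  have hT0 : T ≠ 0 := by
    intro h0
    -- `⟨ξ, Tξ⟩` is the integral of `r`, which is continuous, nonnegative and nonzero at the unit.
    let r : (u ⟶ u) → ℝ := fun g => ‖inner ℂ (τ.op g ξ) ξ‖ ^ 2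
    have hr : Continuous r := (hc.inner continuous_const).norm.pow 2
    have hpos : 0 < ∫ g, r g ∂(isotropyHaar u) := by
      refine hr.integral_pos_of_hasCompactSupport_nonneg_nonzero
        (HasCompactSupport.of_compactSpace r) (fun g => sq_nonneg _) (x := 𝟙 u) ?_
      simpa [r] using hξ
    have : inner ℂ ξ (T ξ) = ((∫ g, r g ∂(isotropyHaar u) : ℝ) : ℂ) := by
      rw [ContinuousLinearMap.integral_apply hΦ, ← integral_inner
        (hΦ.apply_continuousLinearMap ξ), ← integral_complex_ofReal]
      refine integral_congr_ae (.of_forall fun g => ?_)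
      simp only [Φ, r, InnerProductSpace.rankOne_apply, inner_smul_right]
      rw [← inner_conj_symm ξ, Complex.mul_conj']
      simp
    rw [h0, zero_apply, inner_zero_right] at this
    exact hpos.ne (by exact_mod_cast this)
  -- By the spectral theorem; the eigenspace is finite-dimensional by compactness and is the whole
  -- fibre by irreducibility.
  obtain ⟨μ, hμ, hμ0⟩ : ∃ μ, Module.End.HasEigenvalue (T : Module.End ℂ (E u)) μ ∧ μ ≠ 0 := by
    by_contra! h
    exact hT0 ((ContinuousLinearMap.eq_zero_of_forall_hasEigenvalue_eq_zero hcomp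
      hsa.isSymmetric).1 h)
  have hfin := ContinuousLinearMap.finite_dimensional_eigenspace hcomp μ hμ0
  rw [hτ.eigenspace_eq_top hT hμ] at hfin
  exact Module.Finite.equiv (Submodule.topEquiv (R := ℂ) (M := E u))

/-- **Schur's lemma**: an operator commuting with an irreducible isotropy representation is a
scalar. -/
theorem IsIrreducible.eq_smul_id (hτ : τ.IsIrreducible) {u : X} {B : E u →L[ℂ] E u}
    (hB : IsotropyIntertwines τ τ B) : ∃ c : ℂ, B = c • ContinuousLinearMap.id ℂ (E u) := by
  have := hτ.finiteDimensional u
  rcases subsingleton_or_nontrivial (E u) with hs | hu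
  · exact ⟨0, Subsingleton.elim _ _⟩
  obtain ⟨c, hc⟩ := Module.End.exists_eigenvalue (B : Module.End ℂ (E u))
  refine ⟨c, ?_⟩
  ext ζ
  exact Module.End.mem_eigenspace_iff.1 (hτ.eigenspace_eq_top hB hc ▸ Submodule.mem_top)

/-- An intertwiner of irreducible isotropy representations is determined by its trace. -/
theorem IsIrreducible.eq_tr_div_smul_id (hτ : τ.IsIrreducible) {u : X} {B : E u →L[ℂ] E u}
    (hB : IsotropyIntertwines τ τ B) :
    B = (tr B / (Module.finrank ℂ (E u) : ℂ)) • ContinuousLinearMap.id ℂ (E u) := by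
  have := hτ.finiteDimensional u
  rcases subsingleton_or_nontrivial (E u) with hs | hu
  · exact Subsingleton.elim _ _
  obtain ⟨c, rfl⟩ := hτ.eq_smul_id hB
  have h0 : (Module.finrank ℂ (E u) : ℂ) ≠ 0 := by exact_mod_cast Module.finrank_pos.ne'
  have : tr (c • ContinuousLinearMap.id ℂ (E u)) = c * Module.finrank ℂ (E u) := by
    simp [tr, LinearMap.trace_id]
  rw [this, mul_div_cancel_right₀ _ h0]

/-- A nonzero intertwiner between isotropy representations of irreducible representations yields
an equivalence. -/
theorem IsIrreducible.isEquivalent_of_ne_zero (hρ : ρ.IsIrreducible) (hτ : τ.IsIrreducible)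
    {u : X} {B : F u →L[ℂ] E u} (hB : IsotropyIntertwines ρ τ B) (hB0 : B ≠ 0) :
    ρ.IsEquivalent τ := by
  have := hρ.finiteDimensional u
  have := hτ.finiteDimensional u
  obtain ⟨ζ, hζ⟩ : ∃ ζ, B ζ ≠ 0 := by
    by_contra! h
    exact hB0 (ContinuousLinearMap.ext h)
  have hF : Nontrivial (F u) := ⟨ζ, 0, fun h => hζ (by rw [h, map_zero])⟩
  have hE : Nontrivial (E u) := ⟨B ζ, 0, hζ⟩
  have hadj : IsotropyIntertwines τ ρ (ContinuousLinearMap.adjoint B) := fun g ξ => by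
    refine ext_inner_right ℂ fun η => ?_
    rw [ContinuousLinearMap.adjoint_inner_left, inner_op_left, inner_op_left,
      ContinuousLinearMap.adjoint_inner_left, hB]
  -- Since `B*B` is a scalar, `B` is a multiple of an isometry; the normalizing factor `a` is read
  -- off at `ζ`.
  obtain ⟨c, hc⟩ := hρ.eq_smul_id (B := ContinuousLinearMap.adjoint B ∘L B) fun g ξ => by
    simp only [ContinuousLinearMap.comp_apply]
    rw [hB, hadj]
  have hnorm : ∀ ξ, ((‖B ξ‖ ^ 2 : ℝ) : ℂ) = c * ((‖ξ‖ ^ 2 : ℝ) : ℂ) := fun ξ => by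
    have h1 : inner ℂ ξ (ContinuousLinearMap.adjoint B (B ξ)) = c * inner ℂ ξ ξ := by
      rw [← inner_smul_right]
      exact congrArg (fun S : F u →L[ℂ] F u => inner ℂ ξ (S ξ)) hc
    rw [ContinuousLinearMap.adjoint_inner_right, inner_self_eq_norm_sq_to_K,
      inner_self_eq_norm_sq_to_K] at h1
    exact_mod_cast h1
  have hζn : 0 < ‖ζ‖ := norm_pos_iff.2 fun h => hζ (by rw [h, map_zero])
  have hζ0 : 0 < ‖ζ‖ ^ 2 := by positivity
  have hBζ : 0 < ‖B ζ‖ := norm_pos_iff.2 hζ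
  let a : ℝ := ‖ζ‖ / ‖B ζ‖
  have ha : 0 < a := div_pos hζn hBζ
  have hiso : ∀ ξ, ‖((a : ℂ) • B) ξ‖ = ‖ξ‖ := fun ξ => by
    have h1 := hnorm ξ
    have h2 := hnorm ζ
    have hcc : c = ((‖B ζ‖ ^ 2 / ‖ζ‖ ^ 2 : ℝ) : ℂ) := by
      rw [Complex.ofReal_div, h2, mul_div_cancel_right₀]
      exact_mod_cast hζ0.ne'
    rw [hcc, ← Complex.ofReal_mul] at h1
    have h3 : ‖B ξ‖ ^ 2 = ‖B ζ‖ ^ 2 / ‖ζ‖ ^ 2 * ‖ξ‖ ^ 2 := by exact_mod_cast h1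
    rw [smul_apply, norm_smul, Complex.norm_real, Real.norm_eq_abs,
      abs_of_pos ha]
    rw [← sq_eq_sq₀ (by positivity) (norm_nonneg _), mul_pow, h3, div_pow]
    field_simp
  have hsurj : Function.Surjective ((a : ℂ) • B) := by
    have hB' : LinearMap.range (B : F u →ₗ[ℂ] E u) = ⊤ := by
      refine (hτ.isotropy _ (Submodule.closed_of_finiteDimensional _) ?_).resolve_left ?_
      · rintro g _ ⟨ξ, rfl⟩
        exact ⟨ρ.op g ξ, hB g ξ⟩
      · intro h
        have : B ζ ∈ LinearMap.range (B : F u →ₗ[ℂ] E u) := ⟨ζ, rfl⟩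
        rw [h, Submodule.mem_bot] at this
        exact hζ this
    intro η
    obtain ⟨ξ, hξ⟩ := LinearMap.range_eq_top.1 hB' ((a : ℂ)⁻¹ • η)
    refine ⟨ξ, ?_⟩
    have ha' : (a : ℂ) ≠ 0 := by exact_mod_cast ha.ne'
    have hξ' : B ξ = (a : ℂ)⁻¹ • η := hξ
    rw [smul_apply, hξ', smul_inv_smul₀ ha']
  let U : F u ≃ₗᵢ[ℂ] E u := LinearIsometryEquiv.ofSurjective
    ⟨(((a : ℂ) • B : F u →L[ℂ] E u) : F u →ₗ[ℂ] E u), hiso⟩ hsurj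
  let W : F u →L[ℂ] E u := (U.toContinuousLinearEquiv : F u →L[ℂ] E u)
  let W' : E u →L[ℂ] F u := (U.symm.toContinuousLinearEquiv : E u →L[ℂ] F u)
  have hW : IsotropyIntertwines ρ τ W := fun g ξ => by
    change (a : ℂ) • B _ = τ.op g ((a : ℂ) • B ξ)
    rw [hB, map_smul]
  have hW' : IsotropyIntertwines τ ρ W' := fun g ξ => by
    refine U.symm_apply_eq.2 ?_
    refine Eq.trans ?_ (hW g _).symm
    exact congrArg _ (U.apply_symm_apply ξ).symm
  -- The extensions by zero are mutually inverse even off the orbit, because both bundles vanish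
  -- there.
  have hl : ∀ w ξ, extend τ ρ W' w (extend ρ τ W w ξ) = ξ := fun w ξ => by
    by_cases h : Nonempty (w ⟶ u)
    · obtain ⟨x⟩ := h
      rw [extend_apply hW' x, extend_apply hW x, op_op_inv]
      refine Eq.trans (congrArg _ (U.symm_apply_apply _)) (ρ.op_inv_op x ξ)
    · have := hρ.subsingleton_of_isEmpty hF (not_nonempty_iff.1 h)
      exact Subsingleton.elim _ _
  have hr : ∀ w ξ, extend ρ τ W w (extend τ ρ W' w ξ) = ξ := fun w ξ => by
    by_cases h : Nonempty (w ⟶ u)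
    · obtain ⟨x⟩ := h
      rw [extend_apply hW x, extend_apply hW' x, op_op_inv]
      refine Eq.trans (congrArg _ (U.apply_symm_apply _)) (τ.op_inv_op x ξ)
    · have := hτ.subsingleton_of_isEmpty hE (not_nonempty_iff.1 h)
      exact Subsingleton.elim _ _
  have hn : ∀ w ξ, ‖extend ρ τ W w ξ‖ = ‖ξ‖ := fun w ξ => by
    by_cases h : Nonempty (w ⟶ u)
    · obtain ⟨x⟩ := h
      rw [extend_apply hW x, norm_op]
      exact (U.norm_map _).trans (ρ.norm_op x ξ)
    · have := hρ.subsingleton_of_isEmpty hF (not_nonempty_iff.1 h)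
      rw [Subsingleton.elim ξ 0, map_zero, norm_zero, norm_zero]
  have hO := hρ.isOpen_orbit hF
  refine ⟨fun w => LinearIsometryEquiv.ofSurjective
    ⟨(extend ρ τ W w : F w →ₗ[ℂ] E w), hn w⟩ fun η => ⟨_, hr w η⟩,
    fun x ξ => extend_op hW x ξ, fun ξ => ⟨fun hξ => extend_mem_sections hW hO hξ, fun hξ => ?_⟩⟩
  have := extend_mem_sections hW' hO hξ
  convert this using 2 with w
  exact (hl w (ξ w)).symm

theorem IsIrreducible.eq_zero_of_not_isEquivalent (hρ : ρ.IsIrreducible) (hτ : τ.IsIrreducible)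
    (hne : ¬ τ.IsEquivalent ρ) {u : X} {B : F u →L[ℂ] E u} (hB : IsotropyIntertwines ρ τ B) :
    B = 0 := by
  by_contra h
  exact hne (hρ.isEquivalent_of_ne_zero hτ hB h).symm

end UnitaryRep

end IsotropyHaar

/-! ### Linear operations on integrals, and traces -/

section HasIntegral

variable {α : Type*} [MeasurableSpace α] {μ : Measure α}

theorem hasIntegral_zero_measure {V : Type*} [NormedAddCommGroup V] [NormedSpace ℝ V]
    (f : α → V) : HasIntegral (0 : Measure α) f 0 :=
  ⟨integrable_zero_measure, integral_zero_measure f⟩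

theorem HasIntegral.sum {ι V : Type*} [NormedAddCommGroup V] [NormedSpace ℝ V] {s : Finset ι}
    {f : ι → α → V} {a : ι → V} (h : ∀ i ∈ s, HasIntegral μ (f i) (a i)) :
    HasIntegral μ (fun x => ∑ i ∈ s, f i x) (∑ i ∈ s, a i) :=
  ⟨integrable_finsetSum _ fun i hi => (h i hi).1, by
    rw [integral_finsetSum _ fun i hi => (h i hi).1]
    exact Finset.sum_congr rfl fun i hi => (h i hi).2⟩

variable {V W : Type*} [NormedAddCommGroup V] [NormedSpace ℂ V] [FiniteDimensional ℂ V]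
  [NormedAddCommGroup W] [NormedSpace ℂ W] [FiniteDimensional ℂ W]

theorem HasIntegral.map {f : α → V} {a : V} (h : HasIntegral μ f a) (L : V →ₗ[ℂ] W) :
    HasIntegral μ (fun x => L (f x)) (L a) := by
  have := FiniteDimensional.complete ℂ V
  have := FiniteDimensional.complete ℂ W
  refine ⟨(LinearMap.toContinuousLinearMap L).integrable_comp h.1, ?_⟩
  rw [← h.2]
  exact (LinearMap.toContinuousLinearMap L).integral_comp_comm h.1

end HasIntegral

theorem tr_eq_sum_inner {V : Type*} [NormedAddCommGroup V] [InnerProductSpace ℂ V]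
    {ι : Type*} [Fintype ι] (b : OrthonormalBasis ι ℂ V) (T : V →L[ℂ] V) :
    tr T = ∑ i, inner ℂ (b i) (T (b i)) :=
  LinearMap.trace_eq_sum_inner _ b

section FiniteDimensional

variable {V W : Type*} [NormedAddCommGroup V] [InnerProductSpace ℂ V] [FiniteDimensional ℂ V]
  [NormedAddCommGroup W] [InnerProductSpace ℂ W] [FiniteDimensional ℂ W]

theorem tr_comp_comm (T : V →L[ℂ] W) (S : W →L[ℂ] V) : tr (T ∘L S) = tr (S ∘L T) :=
  LinearMap.trace_comp_comm' _ _

theorem tr_rankOne (ξ η : V) : tr (InnerProductSpace.rankOne ℂ ξ η) = inner ℂ η ξ :=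
  InnerProductSpace.trace_rankOne ξ η

theorem tr_adjoint [CompleteSpace V] (T : V →L[ℂ] V) :
    tr (ContinuousLinearMap.adjoint T) = conj (tr T) := by
  rw [tr_eq_sum_inner (stdOrthonormalBasis ℂ V), tr_eq_sum_inner (stdOrthonormalBasis ℂ V),
    map_sum]
  refine Finset.sum_congr rfl fun i _ => ?_
  rw [ContinuousLinearMap.adjoint_inner_right, inner_conj_symm]

end FiniteDimensional

section Orthogonality

/-! Consequences of the first orthogonality relation for families of operators
`p x : V → W` and `q x : W' → V'` indexed by the points of a measure space. -/

variable {α : Type*} [MeasurableSpace α] {μ : Measure α} {V W V' W' : Type*}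
  [NormedAddCommGroup V] [InnerProductSpace ℂ V] [FiniteDimensional ℂ V]
  [NormedAddCommGroup W] [InnerProductSpace ℂ W] [FiniteDimensional ℂ W]
  [NormedAddCommGroup V'] [InnerProductSpace ℂ V'] [FiniteDimensional ℂ V']
  [NormedAddCommGroup W'] [InnerProductSpace ℂ W'] [FiniteDimensional ℂ W']
  {p : α → V →L[ℂ] W} {q : α → W' →L[ℂ] V'} {c : (V' →L[ℂ] V) → W' →L[ℂ] W}

-- Expanding `q x η` in the basis `b` gives vectors `p x (A (q x η)) ⊗ b i` with `A` the rank-one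
-- operator built from `ξ` and `b i`.
omit [FiniteDimensional ℂ V] in
theorem hasIntegral_tmul (h : ∀ A : V' →L[ℂ] V, HasIntegral μ (fun x => p x ∘L A ∘L q x) (c A))
    {ι : Type*} [Fintype ι] (b : OrthonormalBasis ι ℂ V') (ξ : V) (η : W') :
    HasIntegral μ (fun x => p x ξ ⊗ₜ[ℂ] q x η)
      (∑ i, c (InnerProductSpace.rankOne ℂ ξ (b i)) η ⊗ₜ[ℂ] b i) := by
  have key : ∀ i, HasIntegral μ
      (fun x => (inner ℂ (b i) (q x η) • p x ξ) ⊗ₜ[ℂ] b i)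
      (c (InnerProductSpace.rankOne ℂ ξ (b i)) η ⊗ₜ[ℂ] b i) := fun i => by
    have := (h (InnerProductSpace.rankOne ℂ ξ (b i))).map
      (((TensorProduct.mk ℂ W V').flip (b i)) ∘ₗ
        (ContinuousLinearMap.apply ℂ W η : (W' →L[ℂ] W) →ₗ[ℂ] W))
    simpa [TensorProduct.smul_tmul'] using this
  have hs := HasIntegral.sum (s := Finset.univ) fun i _ => key i
  convert hs using 2 with x
  simp_rw [TensorProduct.smul_tmul, ← TensorProduct.tmul_sum]
  rw [b.sum_repr']

-- Expand the trace over `b` and the argument of `q x` over `e`; each term is the contraction of a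
-- tensor by the functional `⟨b i, T ·⟩`.
omit [FiniteDimensional ℂ V] in
theorem hasIntegral_tr_smul {d : V → W' → W ⊗[ℂ] V'}
    (h : ∀ ξ η, HasIntegral μ (fun x => p x ξ ⊗ₜ[ℂ] q x η) (d ξ η))
    {ι κ : Type*} [Fintype ι] [Fintype κ] (b : OrthonormalBasis ι ℂ V)
    (e : OrthonormalBasis κ ℂ W') (T : W →L[ℂ] V) :
    HasIntegral μ (fun x => tr (T ∘L p x) • q x)
      (∑ i, ∑ j, InnerProductSpace.rankOne ℂ
        (TensorProduct.lift ((LinearMap.lsmul ℂ V').comp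
          ((innerSL ℂ (b i) ∘L T : W →L[ℂ] ℂ) : W →ₗ[ℂ] ℂ)) (d (b i) (e j))) (e j)) := by
  have key : ∀ i j, HasIntegral μ
      (fun x => InnerProductSpace.rankOne ℂ (inner ℂ (b i) (T (p x (b i))) • q x (e j)) (e j))
      (InnerProductSpace.rankOne ℂ
        (TensorProduct.lift ((LinearMap.lsmul ℂ V').comp
          ((innerSL ℂ (b i) ∘L T : W →L[ℂ] ℂ) : W →ₗ[ℂ] ℂ)) (d (b i) (e j))) (e j)) :=
    fun i j => by
      -- `R` converts a value at `e j` into the operator with this value that vanishes on the other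
      -- basis vectors.
      let R : V' →ₗ[ℂ] (W' →L[ℂ] V') :=
        { toFun := fun ζ => InnerProductSpace.rankOne ℂ ζ (e j)
          map_add' := fun _ _ => by simp
          map_smul' := fun _ _ => by simp }
      exact (h (b i) (e j)).map (R ∘ₗ TensorProduct.lift ((LinearMap.lsmul ℂ V').comp
        ((innerSL ℂ (b i) ∘L T : W →L[ℂ] ℂ) : W →ₗ[ℂ] ℂ)))
  have hs := HasIntegral.sum (s := Finset.univ) fun i _ =>
    HasIntegral.sum (s := Finset.univ) fun j _ => key i j
  convert hs using 2 with x
  ext η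
  rw [tr_eq_sum_inner b]
  simp only [smul_apply, sum_apply, InnerProductSpace.rankOne_apply,
    ContinuousLinearMap.comp_apply]
  rw [Finset.sum_smul]
  refine Finset.sum_congr rfl fun i _ => ?_
  conv_lhs => rw [← e.sum_repr' η, map_sum, Finset.smul_sum]
  refine Finset.sum_congr rfl fun j _ => ?_
  rw [map_smul, smul_comm]

omit [FiniteDimensional ℂ V] [FiniteDimensional ℂ W] in
theorem hasIntegral_tr_mul_tr {d : (W →L[ℂ] V) → W' →L[ℂ] V'}
    (h : ∀ T, HasIntegral μ (fun x => tr (T ∘L p x) • q x) (d T)) (T : W →L[ℂ] V)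
    (S : V' →L[ℂ] W') :
    HasIntegral μ (fun x => tr (T ∘L p x) * tr (S ∘L q x)) (tr (S ∘L d T)) := by
  let L : (W' →L[ℂ] V') →ₗ[ℂ] ℂ :=
    { toFun := fun R => tr (S ∘L R)
      map_add' := fun _ _ => by simp [tr]
      map_smul' := fun _ _ => by simp [tr] }
  have := (h T).map L
  simp only [map_smul] at this
  exact this

end Orthogonality

/-! ### The operator relation on arrow spaces and range fibres -/

section Averages

variable {X : Type*} [Groupoid X] [TopologicalSpace X] [TopologicalSpace (Arr X)]
  [TopologicalGroupoid X] [CompactSpace (Arr X)] [T2Space (Arr X)]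

theorem homMeasure_of_isEmpty {u v : X} (h : IsEmpty (u ⟶ v)) : homMeasure u v = 0 :=
  dif_neg (not_nonempty_iff.2 h)

omit [CompactSpace (Arr X)] [T2Space (Arr X)] in
theorem measurableEmbedding_comp {u v : X} (z : u ⟶ v) :
    MeasurableEmbedding fun g : u ⟶ u => g ≫ z := by
  let e : (u ⟶ u) ≃ₜ (u ⟶ v) :=
    { toFun := fun g => g ≫ z
      invFun := fun x => x ≫ Groupoid.inv z
      left_inv := fun g => by simp
      right_inv := fun x => by simp
      continuous_toFun := (continuous_homComp u u v).comp (continuous_id.prodMk continuous_const)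
      continuous_invFun := (continuous_homComp u v u).comp (continuous_id.prodMk continuous_const) }
  exact e.toMeasurableEquiv.measurableEmbedding

/-- Integrals over `u ⟶ v` are integrals over the isotropy group at `u`. -/
theorem hasIntegral_homMeasure_iff {V : Type*} [NormedAddCommGroup V] [NormedSpace ℝ V] {u v : X}
    (h : Nonempty (u ⟶ v)) {f : (u ⟶ v) → V} {a : V} :
    HasIntegral (homMeasure u v) f a ↔ HasIntegral (isotropyHaar u) (fun g => f (g ≫ h.some)) a := by
  have he := measurableEmbedding_comp h.some
  rw [homMeasure, dif_pos h, HasIntegral, HasIntegral, he.integrable_map_iff, he.integral_map]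
  rfl

variable {E F : X → Type*}
  [∀ u, NormedAddCommGroup (E u)] [∀ u, InnerProductSpace ℂ (E u)] [∀ u, CompleteSpace (E u)]
  [∀ u, NormedAddCommGroup (F u)] [∀ u, InnerProductSpace ℂ (F u)] [∀ u, CompleteSpace (F u)]
  {τ : UnitaryRep X E} {ρ : UnitaryRep X F}

namespace UnitaryRep

/-- In finite dimension strong continuity is norm continuity, so the average exists as an
operator-valued integral. -/
theorem exists_hasIntegral_conj (hτ : τ.IsIrreducible) (hρ : ρ.IsIrreducible) {u : X}
    (A : F u →L[ℂ] E u) :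
    ∃ B, IsotropyIntertwines ρ τ B ∧
      HasIntegral (isotropyHaar u) (fun g => τ.op g ∘L A ∘L ρ.op (Groupoid.inv g)) B := by
  have := hτ.finiteDimensional u
  have := hρ.finiteDimensional u
  have h1 : Continuous fun g : u ⟶ u => τ.op g :=
    continuous_clm_apply.2 fun ζ => τ.continuous_op_apply u u ζ
  have h2 : Continuous fun g : u ⟶ u => ρ.op g :=
    continuous_clm_apply.2 fun ζ => ρ.continuous_op_apply u u ζ
  have h3 : Continuous fun g : u ⟶ u => ρ.op (Groupoid.inv g) :=
    h2.comp (continuous_inv (G := (u ⟶ u)))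
  have hint := integrable_isotropyHaar (h1.clm_comp (continuous_const.clm_comp h3) :
    Continuous fun g : u ⟶ u => τ.op g ∘L A ∘L ρ.op (Groupoid.inv g))
  refine ⟨_, isotropyIntertwines_integral hint fun g k ξ => ?_, hint, rfl⟩
  have h : ρ.op (Groupoid.inv (g ≫ k)) (ρ.op k ξ) = ρ.op (Groupoid.inv g) ξ := by
    rw [← op_comp_apply]
    congr 1
    simp
  simp only [ContinuousLinearMap.comp_apply]
  rw [h, op_comp_apply]

/-- Writing arrows as `g ≫ z` with `z` fixed, the operators of `z` and its inverse form a linear map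
that leaves the integral. -/
theorem hasIntegral_conj_of_hasIntegral_isotropy (hτ : τ.IsIrreducible) (hρ : ρ.IsIrreducible)
    {u v : X} (h : Nonempty (u ⟶ v)) {A B : F u →L[ℂ] E u}
    (hB : HasIntegral (isotropyHaar u) (fun g => τ.op g ∘L A ∘L ρ.op (Groupoid.inv g)) B) :
    HasIntegral (homMeasure u v) (fun x => τ.op x ∘L A ∘L ρ.op (Groupoid.inv x))
      (τ.op h.some ∘L B ∘L ρ.op (Groupoid.inv h.some)) := by
  have := hτ.finiteDimensional u
  have := hτ.finiteDimensional v
  have := hρ.finiteDimensional u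
  have := hρ.finiteDimensional v
  rw [hasIntegral_homMeasure_iff h]
  let L : (F u →L[ℂ] E u) →ₗ[ℂ] (F v →L[ℂ] E v) :=
    { toFun := fun R => τ.op h.some ∘L R ∘L ρ.op (Groupoid.inv h.some)
      map_add' := fun _ _ => by ext; simp
      map_smul' := fun _ _ => by ext; simp }
  have hL : (fun g : u ⟶ u => τ.op (g ≫ h.some) ∘L A ∘L ρ.op (Groupoid.inv (g ≫ h.some))) =
      fun g => L (τ.op g ∘L A ∘L ρ.op (Groupoid.inv g)) := by
    funext g
    have hinv : Groupoid.inv (g ≫ h.some) = Groupoid.inv h.some ≫ Groupoid.inv g := by simp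
    rw [hinv, op_comp, op_comp]
    rfl
  rw [hL]
  exact hB.map L

/-- The first orthogonality relation for one irreducible representation. -/
theorem IsIrreducible.hasIntegral_conj_self (hτ : τ.IsIrreducible) (u v : X)
    (A : E u →L[ℂ] E u) :
    HasIntegral (homMeasure u v) (fun x : u ⟶ v => τ.op x ∘L A ∘L τ.op (Groupoid.inv x))
      ((tr A / (Module.finrank ℂ (E u) : ℂ)) • ContinuousLinearMap.id ℂ (E v)) := by
  have := hτ.finiteDimensional u
  rcases isEmpty_or_nonempty (u ⟶ v) with h | h
  · rw [homMeasure_of_isEmpty h]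
    convert hasIntegral_zero_measure _
    -- The stated value must vanish: without arrows one of the two fibres is zero. If it is `E u`,
    -- division by zero gives `0`.
    rcases subsingleton_or_nontrivial (E u) with hs | hu
    · simp [Module.finrank_zero_of_subsingleton]
    · rcases subsingleton_or_nontrivial (E v) with hs | hv
      · exact Subsingleton.elim _ _
      · exact (h.elim (hτ.nonempty_hom hu hv).some)
  · obtain ⟨B, hB, hAB⟩ := exists_hasIntegral_conj hτ hτ A
    -- Conjugation preserves the trace and the measure has mass one.
    have htr : tr B = tr A := by
      have h1 := (hAB.map ((LinearMap.trace ℂ (E u)) ∘ₗ ContinuousLinearMap.coeLM ℂ)).2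
      refine Eq.trans h1.symm (Eq.trans (integral_congr_ae (.of_forall fun g => ?_))
        (integral_const (μ := isotropyHaar u) (tr A) |>.trans (by simp)))
      change tr (τ.op g ∘L A ∘L τ.op (Groupoid.inv g)) = tr A
      rw [tr_comp_comm, ContinuousLinearMap.comp_assoc, ← op_comp, Groupoid.comp_inv]
      congr 1
      ext ζ
      simp
    convert hasIntegral_conj_of_hasIntegral_isotropy hτ hτ h hAB using 1
    rw [← htr]
    ext ζ
    have hs := hτ.eq_tr_div_smul_id hB
    -- The scalar itself contains `B`, so it is hidden before rewriting `B`.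
    generalize tr B / (Module.finrank ℂ (E u) : ℂ) = c at hs ⊢
    rw [hs]
    simp only [ContinuousLinearMap.comp_apply, smul_apply, ContinuousLinearMap.id_apply, map_smul,
      op_op_inv]

/-- The first orthogonality relation for inequivalent irreducible representations. -/
theorem IsIrreducible.hasIntegral_conj_of_not_isEquivalent (hτ : τ.IsIrreducible)
    (hρ : ρ.IsIrreducible) (hne : ¬ τ.IsEquivalent ρ) (u v : X) (A : F u →L[ℂ] E u) :
    HasIntegral (homMeasure u v) (fun x : u ⟶ v => τ.op x ∘L A ∘L ρ.op (Groupoid.inv x)) 0 := by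
  rcases isEmpty_or_nonempty (u ⟶ v) with h | h
  · rw [homMeasure_of_isEmpty h]
    exact hasIntegral_zero_measure _
  · obtain ⟨B, hB, hAB⟩ := exists_hasIntegral_conj hτ hρ A
    rw [hρ.eq_zero_of_not_isEquivalent hτ hne hB] at hAB
    convert hasIntegral_conj_of_hasIntegral_isotropy hτ hρ h hAB using 1
    ext ζ
    simp

omit [TopologicalGroupoid X] [CompactSpace (Arr X)] [T2Space (Arr X)] in
theorem tr_adjoint_comp_op_inv (ρ : UnitaryRep X F) {u v : X} [FiniteDimensional ℂ (F u)]
    [FiniteDimensional ℂ (F v)] (S : F v →L[ℂ] F u) (x : u ⟶ v) :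
    tr (ContinuousLinearMap.adjoint S ∘L ρ.op (Groupoid.inv x)) = conj (tr (S ∘L ρ.op x)) := by
  rw [← tr_adjoint, ContinuousLinearMap.adjoint_comp, adjoint_op, tr_comp_comm]

omit [TopologicalGroupoid X] [CompactSpace (Arr X)] [T2Space (Arr X)] in
theorem Intertwines.isotropyIntertwines {A : ∀ w, F w →L[ℂ] E w} (hA : ρ.Intertwines τ A)
    (u : X) : IsotropyIntertwines ρ τ (A u) :=
  fun g ξ => congrArg (fun T : F u →L[ℂ] E u => T ξ) (hA g)

-- The intertwining relation makes the integrand constant; of the Haar system only the normalization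
-- enters.
omit [TopologicalGroupoid X] [CompactSpace (Arr X)] [T2Space (Arr X)] in
theorem Intertwines.hasIntegral_rangeFibre {A : ∀ w, F w →L[ℂ] E w} (hA : ρ.Intertwines τ A)
    (Λ : NormalizedHaarSystem X) (u : X) [FiniteDimensional ℂ (F u)]
    [FiniteDimensional ℂ (E u)] :
    HasIntegral (Λ.measure u)
      (fun x : RangeFibre u => τ.op x.hom ∘L A x.src ∘L ρ.op (Groupoid.inv x.hom)) (A u) := by
  have hconst : (fun x : RangeFibre u => τ.op x.hom ∘L A x.src ∘L ρ.op (Groupoid.inv x.hom)) =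
      fun _ => A u := by
    funext x
    rw [← ContinuousLinearMap.comp_assoc, ← hA x.hom]
    ext ζ
    simp only [ContinuousLinearMap.comp_apply, op_op_inv]
  have : IsProbabilityMeasure (Λ.measure u) := ⟨Λ.normalized u⟩
  rw [hconst]
  exact ⟨integrable_const _, by simp⟩

end UnitaryRep

/-! ### Evaluating the basis sums for equal representations -/

section Sums

variable {V W : Type*}
  [NormedAddCommGroup V] [InnerProductSpace ℂ V] [FiniteDimensional ℂ V]
  [NormedAddCommGroup W] [InnerProductSpace ℂ W] [FiniteDimensional ℂ W]

omit [FiniteDimensional ℂ W] in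
theorem sum_tr_rankOne_smul_tmul {ι : Type*} [Fintype ι] (b : OrthonormalBasis ι ℂ V) (d : ℂ)
    (ξ : V) (η : W) :
    ∑ i, ((tr (InnerProductSpace.rankOne ℂ ξ (b i)) / d) • ContinuousLinearMap.id ℂ W) η ⊗ₜ[ℂ] b i
      = d⁻¹ • (η ⊗ₜ[ℂ] ξ) := by
  conv_rhs => rw [← b.sum_repr' ξ, TensorProduct.tmul_sum, Finset.smul_sum]
  refine Finset.sum_congr rfl fun i _ => ?_
  rw [tr_rankOne, TensorProduct.tmul_smul, smul_smul, smul_apply,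
    ContinuousLinearMap.id_apply, ← TensorProduct.smul_tmul', div_eq_inv_mul]

omit [FiniteDimensional ℂ V] [FiniteDimensional ℂ W] in
theorem sum_rankOne_lift {ι κ : Type*} [Fintype ι] [Fintype κ] (b : OrthonormalBasis ι ℂ V)
    (e : OrthonormalBasis κ ℂ W) (d : ℂ) (T : W →L[ℂ] V) :
    ∑ i, ∑ j, InnerProductSpace.rankOne ℂ
        (TensorProduct.lift ((LinearMap.lsmul ℂ V).comp
          ((innerSL ℂ (b i) ∘L T : W →L[ℂ] ℂ) : W →ₗ[ℂ] ℂ)) (d • (e j ⊗ₜ[ℂ] b i))) (e j)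
      = d • T := by
  rw [Finset.sum_comm]
  ext η
  simp only [sum_apply, InnerProductSpace.rankOne_apply, smul_apply]
  conv_rhs => rw [← e.sum_repr' η, map_sum, Finset.smul_sum]
  refine Finset.sum_congr rfl fun j _ => ?_
  rw [map_smul, ← b.sum_repr' (T (e j)), Finset.smul_sum, Finset.smul_sum]
  refine Finset.sum_congr rfl fun i _ => ?_
  rw [map_smul, smul_comm d]
  rfl

end Sums

end Averages

end GroupoidDuality

/-! ### The orthogonality relations -/

theorem mainTheorem4 {X : Type*} [Groupoid X] [TopologicalSpace X]
    [TopologicalSpace (GroupoidDuality.Arr X)] [GroupoidDuality.TopologicalGroupoid X]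
    [CompactSpace (GroupoidDuality.Arr X)] [T2Space (GroupoidDuality.Arr X)]
    {E F : X → Type*}
    [∀ u, NormedAddCommGroup (E u)] [∀ u, InnerProductSpace ℂ (E u)] [∀ u, CompleteSpace (E u)]
    [∀ u, NormedAddCommGroup (F u)] [∀ u, InnerProductSpace ℂ (F u)] [∀ u, CompleteSpace (F u)]
    (τ : GroupoidDuality.UnitaryRep X E) (ρ : GroupoidDuality.UnitaryRep X F)
    (hτ : τ.IsIrreducible) (hρ : ρ.IsIrreducible) :
    -- the fibres are finite-dimensional, so that traces and dimensions make sense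
    ((∀ u, FiniteDimensional ℂ (E u)) ∧ (∀ u, FiniteDimensional ℂ (F u))) ∧
    -- the case of equal representations
    (∀ u v : X,
      (∀ A : E u →L[ℂ] E u,
        GroupoidDuality.HasIntegral (GroupoidDuality.homMeasure u v)
          (fun x : u ⟶ v => τ.op x ∘L A ∘L τ.op (Groupoid.inv x))
          ((GroupoidDuality.tr A / (Module.finrank ℂ (E u) : ℂ)) •
            ContinuousLinearMap.id ℂ (E v))) ∧
      (∀ (ξ : E u) (η : E v),
        GroupoidDuality.HasIntegral (GroupoidDuality.homMeasure u v)
          (fun x : u ⟶ v => τ.op x ξ ⊗ₜ[ℂ] τ.op (Groupoid.inv x) η)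
          ((Module.finrank ℂ (E u) : ℂ)⁻¹ • (η ⊗ₜ[ℂ] ξ))) ∧
      (∀ (T : E v →L[ℂ] E u) (S : E u →L[ℂ] E v),
        GroupoidDuality.HasIntegral (GroupoidDuality.homMeasure u v)
          (fun x : u ⟶ v => GroupoidDuality.tr (T ∘L τ.op x) *
            GroupoidDuality.tr (S ∘L τ.op (Groupoid.inv x)))
          (GroupoidDuality.tr (T ∘L S) / (Module.finrank ℂ (E u) : ℂ))) ∧
      (∀ T S : E v →L[ℂ] E u,
        GroupoidDuality.HasIntegral (GroupoidDuality.homMeasure u v)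
          (fun x : u ⟶ v => GroupoidDuality.tr (T ∘L τ.op x) *
            conj (GroupoidDuality.tr (S ∘L τ.op x)))
          (GroupoidDuality.tr (T ∘L ContinuousLinearMap.adjoint S) /
            (Module.finrank ℂ (E u) : ℂ))) ∧
      (∀ T : E v →L[ℂ] E u,
        GroupoidDuality.HasIntegral (GroupoidDuality.homMeasure u v)
          (fun x : u ⟶ v => GroupoidDuality.tr (T ∘L τ.op x) • τ.op (Groupoid.inv x))
          ((Module.finrank ℂ (E u) : ℂ)⁻¹ • T))) ∧
    -- the case of inequivalent representations
    (¬ τ.IsEquivalent ρ → ∀ u v : X,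
      (∀ A : F u →L[ℂ] E u,
        GroupoidDuality.HasIntegral (GroupoidDuality.homMeasure u v)
          (fun x : u ⟶ v => τ.op x ∘L A ∘L ρ.op (Groupoid.inv x)) 0) ∧
      (∀ (ξ : E u) (η : F v),
        GroupoidDuality.HasIntegral (GroupoidDuality.homMeasure u v)
          (fun x : u ⟶ v => τ.op x ξ ⊗ₜ[ℂ] ρ.op (Groupoid.inv x) η) 0) ∧
      (∀ (T : E v →L[ℂ] E u) (S : F u →L[ℂ] F v),
        GroupoidDuality.HasIntegral (GroupoidDuality.homMeasure u v)
          (fun x : u ⟶ v => GroupoidDuality.tr (T ∘L τ.op x) *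
            GroupoidDuality.tr (S ∘L ρ.op (Groupoid.inv x))) 0) ∧
      (∀ (T : E v →L[ℂ] E u) (S : F v →L[ℂ] F u),
        GroupoidDuality.HasIntegral (GroupoidDuality.homMeasure u v)
          (fun x : u ⟶ v => GroupoidDuality.tr (T ∘L τ.op x) *
            conj (GroupoidDuality.tr (S ∘L ρ.op x))) 0) ∧
      (∀ T : E v →L[ℂ] E u,
        GroupoidDuality.HasIntegral (GroupoidDuality.homMeasure u v)
          (fun x : u ⟶ v => GroupoidDuality.tr (T ∘L τ.op x) • ρ.op (Groupoid.inv x)) 0)) ∧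
    -- the first relation for intertwiners, integrated over a whole range fibre
    (∀ (Λ : GroupoidDuality.NormalizedHaarSystem X) (u : X),
      (∀ A : ∀ w, E w →L[ℂ] E w, τ.Intertwines τ A →
        GroupoidDuality.HasIntegral (Λ.measure u)
          (fun x : GroupoidDuality.RangeFibre u =>
            τ.op x.hom ∘L A x.src ∘L τ.op (Groupoid.inv x.hom))
          ((GroupoidDuality.tr (A u) / (Module.finrank ℂ (E u) : ℂ)) •
            ContinuousLinearMap.id ℂ (E u))) ∧
      (¬ τ.IsEquivalent ρ → ∀ A : ∀ w, F w →L[ℂ] E w, ρ.Intertwines τ A →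
        GroupoidDuality.HasIntegral (Λ.measure u)
          (fun x : GroupoidDuality.RangeFibre u =>
            τ.op x.hom ∘L A x.src ∘L ρ.op (Groupoid.inv x.hom)) 0)) := by
  have hE := hτ.finiteDimensional
  have hF := hρ.finiteDimensional
  refine ⟨⟨hE, hF⟩, fun u v => ?_, fun hne u v => ?_, fun Λ u => ⟨fun A hA => ?_,
    fun hne A hA => ?_⟩⟩
  · have h1 := hτ.hasIntegral_conj_self u v
    have h2 : ∀ (ξ : E u) (η : E v), GroupoidDuality.HasIntegral _ _ _ := fun ξ η =>
      GroupoidDuality.sum_tr_rankOne_smul_tmul (stdOrthonormalBasis ℂ (E u)) _ ξ η ▸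
        GroupoidDuality.hasIntegral_tmul h1 (stdOrthonormalBasis ℂ (E u)) ξ η
    -- The operator-valued relation precedes the product of traces, which follows by applying `tr (S
    -- ∘L ·)`.
    have h5 : ∀ T : E v →L[ℂ] E u, GroupoidDuality.HasIntegral _ _ _ := fun T =>
      GroupoidDuality.sum_rankOne_lift (stdOrthonormalBasis ℂ (E u))
        (stdOrthonormalBasis ℂ (E v)) _ T ▸
        GroupoidDuality.hasIntegral_tr_smul h2 (stdOrthonormalBasis ℂ (E u))
          (stdOrthonormalBasis ℂ (E v)) T
    have h3 : ∀ (T : E v →L[ℂ] E u) (S : E u →L[ℂ] E v),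
        GroupoidDuality.HasIntegral (GroupoidDuality.homMeasure u v)
          (fun x : u ⟶ v => GroupoidDuality.tr (T ∘L τ.op x) *
            GroupoidDuality.tr (S ∘L τ.op (Groupoid.inv x)))
          (GroupoidDuality.tr (T ∘L S) / (Module.finrank ℂ (E u) : ℂ)) := fun T S => by
      convert GroupoidDuality.hasIntegral_tr_mul_tr h5 T S using 1
      rw [GroupoidDuality.tr_comp_comm T S, div_eq_inv_mul]
      simp [GroupoidDuality.tr]
    refine ⟨h1, h2, h3, fun T S => ?_, h5⟩
    -- Unitarity turns the conjugated trace into a trace against `τ(x⁻¹)` with `S` replaced by its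
    -- adjoint.
    convert h3 T (ContinuousLinearMap.adjoint S) using 3 with x
    rw [τ.tr_adjoint_comp_op_inv S x]
  · have h1 := hτ.hasIntegral_conj_of_not_isEquivalent hρ hne u v
    have h2 : ∀ (ξ : E u) (η : F v), GroupoidDuality.HasIntegral
        (GroupoidDuality.homMeasure u v)
        (fun x : u ⟶ v => τ.op x ξ ⊗ₜ[ℂ] ρ.op (Groupoid.inv x) η) 0 := fun ξ η => by
      simpa using GroupoidDuality.hasIntegral_tmul h1 (stdOrthonormalBasis ℂ (F u)) ξ η
    have h5 : ∀ T : E v →L[ℂ] E u, GroupoidDuality.HasIntegral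
        (GroupoidDuality.homMeasure u v)
        (fun x : u ⟶ v => GroupoidDuality.tr (T ∘L τ.op x) • ρ.op (Groupoid.inv x)) 0 :=
      fun T => by
        simpa only [map_zero, zero_apply, Finset.sum_const_zero] using
          GroupoidDuality.hasIntegral_tr_smul h2 (stdOrthonormalBasis ℂ (E u))
            (stdOrthonormalBasis ℂ (F v)) T
    have h3 : ∀ (T : E v →L[ℂ] E u) (S : F u →L[ℂ] F v),
        GroupoidDuality.HasIntegral (GroupoidDuality.homMeasure u v)
          (fun x : u ⟶ v => GroupoidDuality.tr (T ∘L τ.op x) *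
            GroupoidDuality.tr (S ∘L ρ.op (Groupoid.inv x))) 0 := fun T S => by
      convert GroupoidDuality.hasIntegral_tr_mul_tr h5 T S using 1
      simp [GroupoidDuality.tr]
    refine ⟨h1, h2, h3, fun T S => ?_, h5⟩
    convert h3 T (ContinuousLinearMap.adjoint S) using 3 with x
    rw [ρ.tr_adjoint_comp_op_inv S x]
  -- By Schur's lemma the claimed value is `A u` itself.
  · rw [← hτ.eq_tr_div_smul_id (hA.isotropyIntertwines u)]
    exact hA.hasIntegral_rangeFibre Λ u
  · rw [← hρ.eq_zero_of_not_isEquivalent hτ hne (hA.isotropyIntertwines u)]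
    exact hA.hasIntegral_rangeFibre Λ u
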